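/- For $n\ge 0$ let $\mathcal S_n(1423,2413)$ be the set of permutations of $\{1,\dots,n\}$, in one-line notation, that avoid both patterns $1423$ and $2413$, and let $\mathcal S_n^{1\prec n}(1423,2413)$ be the subset of those $\sigma$ in which entry $1$ is strictly to the left of entry $n$. For $2\le k\le n$ let $a_{n,k}$ be the number of $\sigma\in\mathcal S_n^{1\prec n}(1423,2413)$ with $\sigma(k)=n$, and let $g(x,t)=\sum_{n\ge2}\sum_{k=2}^n a_{n,k}\,t^kx^n\in\mathbb Q[[x,t]]$. Let $r_0,r_1,r_2,\dots=1,2,6,22,90,\dots$ be the large Schröder numbers, given by $r_0=1$ and $r_{n+1}=r_n+\sum_{i=0}^n r_ir_{n-i}$, and let $S(x)=1+\sum_{n\ge1}r_{n-1}x^n=1+x+2x^2+6x^3+22x^4+\cdots\in\mathbb Q[[x]]$. Then: (1) $S(x)=\tfrac12\bigl(3-x-\sqrt{x^2-6x+1}\,\bigr)$, where the square root is the formal power series with constant term $1$. (2) $1+t-S(xt)\ne0$, and in the field of fractions of $\mathbb Q[[x,t]]$ $$g(x,t)=\frac{x\,t^2\,(S(xt)-1)}{1+t-S(xt)}.$$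 (3) $\sum_{n\ge0}|\mathcal S_n^{1\prec n}(1423,2413)|\,x^n=g(x,1)=\dfrac{x\,(S(x)-1)}{2-S(x)}$, where $g(x,1)$ denotes $\sum_{n\ge2}\bigl(\sum_{k=2}^n a_{n,k}\bigr)x^n$. Its coefficients are the little Schröder numbers: $|\mathcal S_n^{1\prec n}(1423,2413)|=\tfrac12 r_{n-1}$ for all $n\ge2$, that is, $1,3,11,45,197,903,\dots$ for $n=2,3,4,\dots$. (4) $|\mathcal S_n(1423,2413)|=r_{n-1}$ for all $n\ge1$. -/

import Mathlib

/-- The word `w` occurs as a pattern in `σ` (both read in one-line notation): some subsequence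
`σ (f 0), σ (f 1), …` is in the same relative order as `w 0, w 1, …`. -/
def ContainsPattern {n k : ℕ} (σ : Equiv.Perm (Fin n)) (w : Fin k → ℕ) : Prop :=
  ∃ f : Fin k ↪o Fin n, ∀ i j : Fin k, σ (f i) < σ (f j) ↔ w i < w j

/-- The class of permutations of size `n` avoiding both `1423` and `2413`. Positions and entries
are elements of `Fin n`; position `i` stands for `i + 1`, and likewise for entries. -/
def avoiders (n : ℕ) : Set (Equiv.Perm (Fin n)) :=
  {σ | ¬ ContainsPattern σ ![1, 4, 2, 3] ∧ ¬ ContainsPattern σ ![2, 4, 1, 3]}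

/-- The `(1423, 2413)`-avoiders of size `n` with entry `1` strictly to the left of entry `n`. -/
def avoidersOneBeforeMax (n : ℕ) : Set (Equiv.Perm (Fin n)) :=
  {σ | σ ∈ avoiders n ∧
    ∃ i j : Fin n, i < j ∧ (σ i : ℕ) + 1 = 1 ∧ (σ j : ℕ) + 1 = n}

/-- Those members of `avoidersOneBeforeMax n` that have entry `n` at position `k`
(positions are counted from `1`). -/
def avoidersMaxAt (n k : ℕ) : Set (Equiv.Perm (Fin n)) :=
  {σ | σ ∈ avoidersOneBeforeMax n ∧ ∃ j : Fin n, (j : ℕ) + 1 = k ∧ (σ j : ℕ) + 1 = n}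

/-- The numbers `a_{n,k}`. -/
noncomputable def maxAtCount (n k : ℕ) : ℕ := (avoidersMaxAt n k).ncard

/-- The series `S = 1 + x + 2 x ^ 2 + 6 x ^ 3 + 22 x ^ 4 + ⋯`: constant term `1`, and for
`n ≥ 1` the coefficient of `x ^ n` is the large Schröder number with index `n - 1`. -/
noncomputable def schroderS : PowerSeries ℚ :=
  PowerSeries.mk fun n => if n = 0 then 1 else (Nat.largeSchroder (n - 1) : ℚ)

/-- The variable `x` of `ℚ⟦x, t⟧`. -/
noncomputable def varX : MvPowerSeries (Fin 2) ℚ := MvPowerSeries.X 0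

/-- The variable `t` of `ℚ⟦x, t⟧`. -/
noncomputable def varT : MvPowerSeries (Fin 2) ℚ := MvPowerSeries.X 1

/-- `x t` has zero constant term, so it may be substituted into any power series. -/
theorem hasSubst_varX_mul_varT : PowerSeries.HasSubst (varX * varT) :=
  PowerSeries.HasSubst.of_constantCoeff_zero (by simp [varX, varT])

/-- The series `S (x t)` in `ℚ⟦x, t⟧`. -/
noncomputable def schroderSxt : MvPowerSeries (Fin 2) ℚ :=
  PowerSeries.subst (varX * varT) schroderS

/-- The generating function `g (x, t) = ∑_{n ≥ 2} ∑_{2 ≤ k ≤ n} a_{n,k} t ^ k x ^ n`; the exponent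
vector `m` stands for `x ^ (m 0) * t ^ (m 1)`. -/
noncomputable def maxAtSeries : MvPowerSeries (Fin 2) ℚ :=
  fun m => if 2 ≤ m 0 ∧ 2 ≤ m 1 ∧ m 1 ≤ m 0 then (maxAtCount (m 0) (m 1) : ℚ) else 0

/-- The series `∑_{n ≥ 2} (∑_{2 ≤ k ≤ n} a_{n,k}) x ^ n`, that is, `g (x, 1)`. -/
noncomputable def maxAtSeriesAtOne : PowerSeries ℚ :=
  PowerSeries.mk fun n => if 2 ≤ n then ∑ k ∈ Finset.Icc 2 n, (maxAtCount n k : ℚ) else 0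

/-! Together the two patterns forbid exactly this: positions p < q < r < s at which the entry at s
exceeds those at p and r but not the one at q. So everything is governed by the last entry. Count
entries from 0 and let the last entry be v ≥ 1. An entry above v between two entries below v would
complete a forbidden pattern with the last one, so the v entries below v occupy an interval of
positions (`exists_block`). Contracting that block to a single minimum and deleting the last entry
leaves an avoider of size M; the block itself is an avoider of size v. Conversely, every such pair
arises from exactly one avoider of size M + v (`bijOn_inflation`). If v = 0, the last entry can
simply be deleted. Summing over v gives the Schröder recurrence (`ncard_avoiders`).

The same decomposition tracks the maximum. For M ≥ 2 the maximum comes from the contracted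
permutation, its position shifted by v - 1 when it stands to the right of the block, and the minimum
lies in the block; so "1 before n" passes to the contracted permutation. For M = 1 the maximum is
last and the condition is automatic; for v = 0 it fails. This is `maxAtCount_rec`, equivalent to t g
= x t² (S(xt) - 1) + (S(xt) - 1) g. At t = 1 the quadratic equation for S reduces the quotient to (S
- 1 - x)/2, whence the little Schröder numbers. -/

/-! ### Permutations as functions on ℕ, and avoidance -/

/-- A permutation of `Fin n`, as a function on `ℕ` that fixes all `i ≥ n`. -/
def natFun {n : ℕ} (σ : Equiv.Perm (Fin n)) (i : ℕ) : ℕ :=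
  if h : i < n then σ ⟨i, h⟩ else i

theorem natFun_coe {n : ℕ} (σ : Equiv.Perm (Fin n)) (i : Fin n) : natFun σ i = σ i := by
  simp [natFun]

theorem natFun_lt {n : ℕ} (σ : Equiv.Perm (Fin n)) {i : ℕ} (h : i < n) : natFun σ i < n := by
  simp [natFun, h]

theorem natFun_inj {n : ℕ} (σ : Equiv.Perm (Fin n)) {i j : ℕ} (hi : i < n) (hj : j < n)
    (h : natFun σ i = natFun σ j) : i = j := by
  simpa [natFun, hi, hj, Fin.val_inj] using h

theorem natFun_ext {n : ℕ} {σ τ : Equiv.Perm (Fin n)} (h : ∀ i < n, natFun σ i = natFun τ i) :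
    σ = τ := by
  ext i
  simpa [natFun] using h i i.2

theorem natFun_symm {n : ℕ} (σ : Equiv.Perm (Fin n)) (i : ℕ) :
    natFun σ (natFun σ.symm i) = i := by
  by_cases h : i < n <;> simp [natFun, h]

/-- The permutation of `Fin n` that agrees with `f` on `{0, …, n - 1}`, if there is one. -/
noncomputable def ofNatFun (n : ℕ) (f : ℕ → ℕ) : Equiv.Perm (Fin n) :=
  open Classical in
  if h : (∀ i < n, f i < n) ∧ ∀ i < n, ∀ j < n, f i = f j → i = j then
    Equiv.ofBijective (fun i : Fin n => (⟨f i, h.1 i i.2⟩ : Fin n)) <|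
      Finite.injective_iff_bijective.1 fun i j hij =>
        Fin.ext (h.2 i i.2 j j.2 (by simpa using hij))
  else 1

theorem natFun_ofNatFun {n : ℕ} {f : ℕ → ℕ} (h1 : ∀ i < n, f i < n)
    (h2 : ∀ i < n, ∀ j < n, f i = f j → i = j) {i : ℕ} (hi : i < n) :
    natFun (ofNatFun n f) i = f i := by
  rw [ofNatFun, dif_pos ⟨h1, h2⟩]
  simp [natFun, hi]

/-- The sequence `f 0, …, f (n - 1)` has no subsequence with the pattern `1423` or `2413`. -/
def SeqAvoids (n : ℕ) (f : ℕ → ℕ) : Prop :=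
  ∀ p q r s, p < q → q < r → r < s → s < n → f p < f s → f r < f s → f s < f q → False

theorem SeqAvoids.congr {n : ℕ} {f g : ℕ → ℕ} (h : SeqAvoids n f) (hfg : ∀ i < n, g i = f i) :
    SeqAvoids n g := by
  intro p q r s hpq hqr hrs hs
  rw [hfg p (by lia), hfg q (by lia), hfg r (by lia), hfg s hs]
  exact h p q r s hpq hqr hrs hs

theorem containsPattern_of_natFun {n : ℕ} (σ : Equiv.Perm (Fin n)) (w : Fin 4 → ℕ) (g : Fin 4 → ℕ)
    (hg : StrictMono g) (hn : ∀ i, g i < n)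
    (hw : ∀ i j, natFun σ (g i) < natFun σ (g j) ↔ w i < w j) : ContainsPattern σ w := by
  refine ⟨OrderEmbedding.ofStrictMono (fun i => (⟨g i, hn i⟩ : Fin n)) fun i j h => hg h, ?_⟩
  intro i j
  rw [← hw]
  simp only [natFun, hn, dif_pos, Fin.val_fin_lt]
  rfl

/-- 1423 and 2413 differ only in the relative order of their first and third letters, so avoiding
both leaves that order unconstrained. -/
theorem mem_avoiders_iff {n : ℕ} (σ : Equiv.Perm (Fin n)) :
    σ ∈ avoiders n ↔ SeqAvoids n (natFun σ) := by
  constructor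
  · rintro ⟨h1, h2⟩ p q r s hpq hqr hrs hs hps hrs' hsq
    have hg : StrictMono ![p, q, r, s] := by
      rw [Fin.strictMono_iff_lt_succ]
      intro i
      fin_cases i <;> simpa
    have hn : ∀ i, ![p, q, r, s] i < n := by
      intro i
      fin_cases i <;> simp <;> lia
    have hne : natFun σ p ≠ natFun σ r := fun h => by
      have := natFun_inj σ (by lia) (by lia) h
      lia
    rcases lt_or_gt_of_ne hne with h | h
    · refine h1 (containsPattern_of_natFun σ _ _ hg hn fun i j => ?_)
      fin_cases i <;> fin_cases j <;> simp <;> lia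
    · refine h2 (containsPattern_of_natFun σ _ _ hg hn fun i j => ?_)
      fin_cases i <;> fin_cases j <;> simp <;> lia
  · intro h
    have key : ∀ w : Fin 4 → ℕ, w 0 < w 3 → w 2 < w 3 → w 3 < w 1 → ¬ ContainsPattern σ w := by
      rintro w h1 h2 h3 ⟨f, hf⟩
      refine h (f 0) (f 1) (f 2) (f 3) (by simp) (by simp)
        (by simp) (f 3).2 ?_ ?_ ?_ <;>
      · rw [natFun_coe, natFun_coe, Fin.val_fin_lt, hf]
        assumption
    exact ⟨key _ (by simp) (by simp) (by simp), key _ (by simp) (by simp) (by simp)⟩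

/-! ### Inflating the minimum -/

/-- Inflate the entry `r p₀` of `r 0, …, r (M - 1)` to the block `q 0, …, q (v - 1)`, then append
the entry `v`. -/
def inflate (M v p₀ : ℕ) (r q : ℕ → ℕ) (p : ℕ) : ℕ :=
  if p < p₀ then r p + v
  else if p < p₀ + v then q (p - p₀)
  else if p + 1 < M + v then r (p + 1 - v) + v
  else v

section inflate

variable {M v p₀ : ℕ} {r q : ℕ → ℕ}

theorem inflate_lt (hv : 1 ≤ v) (hp : p₀ < M) (hr : ∀ i < M, r i < M) (hq : ∀ i < v, q i < v) :
    ∀ i < M + v, inflate M v p₀ r q i < M + v := by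
  intro i hi
  unfold inflate
  split_ifs
  · have := hr i (by lia)
    lia
  · have := hq (i - p₀) (by lia)
    lia
  · have := hr (i + 1 - v) (by lia)
    lia
  · lia

theorem inflate_inj (hv : 1 ≤ v) (hp : p₀ < M) (hr0 : ∀ i < M, i ≠ p₀ → 0 < r i)
    (hr : ∀ i < M, ∀ j < M, r i = r j → i = j)
    (hq : ∀ i < v, q i < v) (hq' : ∀ i < v, ∀ j < v, q i = q j → i = j) :
    ∀ i < M + v, ∀ j < M + v, inflate M v p₀ r q i = inflate M v p₀ r q j → i = j := by
  intro i hi j hj h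
  unfold inflate at h
  have a1 := hr0 i
  have a2 := hr0 j
  have a3 := hr0 (i + 1 - v)
  have a4 := hr0 (j + 1 - v)
  have a5 := hq (i - p₀)
  have a6 := hq (j - p₀)
  have a7 := hq' (i - p₀)
  have b1 := hr i
  have b2 := hr (i + 1 - v)
  split_ifs at h
  all_goals first
    | lia
    | (have := b1 (by lia) j (by lia) (by lia); lia)
    | (have := b1 (by lia) (j + 1 - v) (by lia) (by lia); lia)
    | (have := b2 (by lia) j (by lia) (by lia); lia)
    | (have := b2 (by lia) (j + 1 - v) (by lia) (by lia); lia)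
    | (have := a7 (by lia) (j - p₀) (by lia) (by lia); lia)

/-- Consider where the last letter w of a forbidden pattern falls. At the final position: x and z
lie in the block, hence so does y, whose entry is then too small. In the block: x is in the block,
so all four are, and `q` has the pattern. Elsewhere: y lies outside the block because its entry
exceeds v, and contracting the block turns the pattern into one of `r`. -/
theorem inflate_seqAvoids (hv : 1 ≤ v) (hp : p₀ < M) (hr0 : ∀ i < M, i ≠ p₀ → 0 < r i)
    (hrp : r p₀ = 0) (hq : ∀ i < v, q i < v) (hr : SeqAvoids M r) (hq' : SeqAvoids v q) :
    SeqAvoids (M + v) (inflate M v p₀ r q) := by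
  have block : ∀ p, p₀ ≤ p → p < p₀ + v → inflate M v p₀ r q p = q (p - p₀) ∧
      inflate M v p₀ r q p < v := by
    intro p h1 h2
    have := hq (p - p₀) (by lia)
    simp [inflate, not_lt.2 h1, h2, this]
  have out : ∀ p, p + 1 < M + v → (p < p₀ ∨ p₀ + v ≤ p) → v < inflate M v p₀ r q p := by
    intro p h1 h2
    unfold inflate
    split_ifs
    · have := hr0 p (by lia) (by lia)
      lia
    · lia
    · have := hr0 (p + 1 - v) (by lia) (by lia)
      lia
  have last : inflate M v p₀ r q (M + v - 1) = v := by
    unfold inflate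
    split_ifs <;> lia
  -- `c` contracts the block to the position `p₀` of the minimum of `r`.
  obtain ⟨c, hc⟩ : ∃ c : ℕ → ℕ, ∀ p, c p = if p < p₀ then p else if p < p₀ + v then p₀
      else p + 1 - v := ⟨_, fun _ => rfl⟩
  have hcr : ∀ p, p + 1 < M + v → (p < p₀ ∨ p₀ + v ≤ p) →
      inflate M v p₀ r q p = r (c p) + v := by
    intro p h1 h2
    rw [hc]
    unfold inflate
    split_ifs <;> first | rfl | lia
  intro x y z w hxy hyz hzw hw h1 h2 h3
  by_cases hwl : w = M + v - 1
  · have e1 := out x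
    have e2 := out z
    have e3 := block y
    rw [hwl, last] at h1 h2 h3
    lia
  · by_cases hwb : p₀ ≤ w ∧ w < p₀ + v
    · have e0 := block w hwb.1 hwb.2
      have e1 := out x
      have e2 := out z
      have hx : p₀ ≤ x := by lia
      have ex := block x hx (by lia)
      have ey := block y (by lia) (by lia)
      have ez := block z (by lia) (by lia)
      rw [ex.1, e0.1] at h1
      rw [ez.1, e0.1] at h2
      rw [ey.1, e0.1] at h3
      exact hq' (x - p₀) (y - p₀) (z - p₀) (w - p₀) (by lia) (by lia) (by lia) (by lia) h1 h2 h3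
    · have ew := hcr w (by lia) (by lia)
      have ow := out w (by lia) (by lia)
      have hy : y < p₀ ∨ p₀ + v ≤ y := by
        by_contra h
        have := block y (by lia) (by lia)
        lia
      have ey := hcr y (by lia) hy
      have aux : ∀ u, u < w → inflate M v p₀ r q u < inflate M v p₀ r q w → r (c u) < r (c w) := by
        intro u hu h
        by_cases hub : p₀ ≤ u ∧ u < p₀ + v
        · have : c u = p₀ := by
            rw [hc]
            split_ifs <;> lia
          rw [this, hrp]
          lia
        · have := hcr u (by lia) (by lia)
          lia
      refine hr (c x) (c y) (c z) (c w) ?_ ?_ ?_ ?_ (aux x (by lia) h1) (aux z (by lia) h2) (by lia)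
      all_goals
        simp only [hc]
        split_ifs <;> lia

end inflate

/-! ### Decomposition by the last entry -/

theorem card_filter_natFun_lt {n v : ℕ} (σ : Equiv.Perm (Fin n)) (hv : v ≤ n) :
    ((Finset.range n).filter fun i => natFun σ i < v).card = v := by
  conv_rhs => rw [← Finset.card_range v]
  refine Finset.card_bij (fun i _ => natFun σ i) ?_ ?_ ?_
  · simp
  · intro i hi j hj h
    simp only [Finset.mem_filter, Finset.mem_range] at hi hj
    exact natFun_inj σ hi.1 hj.1 h
  · intro b hb
    rw [Finset.mem_range] at hb
    have := natFun_lt σ.symm (i := b) (by lia)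
    refine ⟨natFun σ.symm b, ?_, natFun_symm σ b⟩
    simp [natFun_symm, hb, this]

/-- In an avoider with last entry `v`, the entries less than `v` occupy an interval. -/
theorem exists_block {M v : ℕ} (hv : 1 ≤ v) (σ : Equiv.Perm (Fin (M + v)))
    (hσ : SeqAvoids (M + v) (natFun σ)) (hlast : natFun σ (M + v - 1) = v) :
    ∃ p₀ < M, ∀ i < M + v, natFun σ i < v ↔ p₀ ≤ i ∧ i < p₀ + v := by
  have hcard := card_filter_natFun_lt σ (v := v) (by lia)
  set P := (Finset.range (M + v)).filter fun i => natFun σ i < v with hP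
  have hne : P.Nonempty := by
    rw [← Finset.card_pos]
    lia
  have hmem : ∀ i, i ∈ P ↔ i < M + v ∧ natFun σ i < v := by simp [hP]
  obtain ⟨ha, ha'⟩ := (hmem _).1 (P.min'_mem hne)
  obtain ⟨hb, hb'⟩ := (hmem _).1 (P.max'_mem hne)
  have hab := P.min'_le _ (P.max'_mem hne)
  have hmin := P.min'_le
  have hmax := P.le_max'
  set a := P.min' hne
  set b := P.max' hne
  have hbl : b ≠ M + v - 1 := by
    intro h
    rw [h] at hb'
    lia
  -- An entry above v strictly between the extreme positions a and b would form a forbidden pattern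
  -- with those two and the last entry.
  have hIcc : P = Finset.Icc a b := by
    ext i
    rw [Finset.mem_Icc]
    refine ⟨fun hi => ⟨hmin i hi, hmax i hi⟩, fun ⟨h1, h2⟩ => ?_⟩
    rw [hmem]
    refine ⟨by lia, ?_⟩
    by_contra h
    have h3 : natFun σ i ≠ v := fun h => by
      have := natFun_inj σ (i := i) (j := M + v - 1) (by lia) (by lia) (by lia)
      lia
    have h4 : i ≠ a := by
      rintro rfl
      lia
    have h5 : i ≠ b := by
      rintro rfl
      lia
    exact hσ a i b (M + v - 1) (by lia) (by lia) (by lia) (by lia) (by lia) (by lia) (by lia)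
  rw [hIcc, Nat.card_Icc] at hcard
  refine ⟨a, by lia, fun i hi => ?_⟩
  have := hmem i
  rw [hIcc, Finset.mem_Icc] at this
  lia

theorem natFun_symm_zero_unique {n : ℕ} (σ : Equiv.Perm (Fin n)) {i : ℕ} (hi : i < n)
    (h : i ≠ natFun σ.symm 0) : 0 < natFun σ i := by
  by_contra h0
  refine h (natFun_inj σ hi (natFun_lt _ (by lia)) ?_)
  rw [natFun_symm]
  lia

/-- The permutation that arises from `ρ` by inflating its smallest entry to a copy of `π`, and
appending an entry that exceeds exactly the entries of that copy. -/
noncomputable def inflation {M v : ℕ} (ρ : Equiv.Perm (Fin M)) (π : Equiv.Perm (Fin v)) :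
    Equiv.Perm (Fin (M + v)) :=
  ofNatFun (M + v) (inflate M v (natFun ρ.symm 0) (natFun ρ) (natFun π))

section inflation

variable {M v : ℕ} (hv : 1 ≤ v) (hM : 1 ≤ M)

include hv hM

theorem natFun_inflation (ρ : Equiv.Perm (Fin M)) (π : Equiv.Perm (Fin v)) {i : ℕ}
    (hi : i < M + v) :
    natFun (inflation ρ π) i = inflate M v (natFun ρ.symm 0) (natFun ρ) (natFun π) i :=
  natFun_ofNatFun
    (inflate_lt hv (natFun_lt _ hM) (fun _ => natFun_lt ρ) (fun _ => natFun_lt π))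
    (inflate_inj hv (natFun_lt _ hM) (fun _ => natFun_symm_zero_unique ρ)
      (fun _ hi _ hj => natFun_inj ρ hi hj) (fun _ => natFun_lt π)
      (fun _ hi _ hj => natFun_inj π hi hj)) hi

theorem natFun_inflation_last (ρ : Equiv.Perm (Fin M)) (π : Equiv.Perm (Fin v)) :
    natFun (inflation ρ π) (M + v - 1) = v := by
  rw [natFun_inflation hv hM _ _ (by lia)]
  have := natFun_lt ρ.symm hM
  unfold inflate
  split_ifs <;> lia

theorem natFun_inflation_lt_iff (ρ : Equiv.Perm (Fin M)) (π : Equiv.Perm (Fin v)) {i : ℕ}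
    (hi : i < M + v) :
    natFun (inflation ρ π) i < v ↔ natFun ρ.symm 0 ≤ i ∧ i < natFun ρ.symm 0 + v := by
  rw [natFun_inflation hv hM _ _ hi]
  have := natFun_lt π (i := i - natFun ρ.symm 0)
  unfold inflate
  split_ifs <;> lia

theorem inflation_mem_avoiders {ρ : Equiv.Perm (Fin M)} {π : Equiv.Perm (Fin v)}
    (hρ : ρ ∈ avoiders M) (hπ : π ∈ avoiders v) : inflation ρ π ∈ avoiders (M + v) := by
  rw [mem_avoiders_iff] at *
  exact (inflate_seqAvoids hv (natFun_lt _ hM) (fun _ => natFun_symm_zero_unique ρ)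
    (natFun_symm ρ 0) (fun _ => natFun_lt π) hρ hπ).congr fun i => natFun_inflation hv hM ρ π

theorem inflation_inj {ρ ρ' : Equiv.Perm (Fin M)} {π π' : Equiv.Perm (Fin v)}
    (h : inflation ρ π = inflation ρ' π') : ρ = ρ' ∧ π = π' := by
  have hb := fun i hi => natFun_inflation_lt_iff hv hM ρ π (i := i) hi
  have hb' := fun i hi => natFun_inflation_lt_iff hv hM ρ' π' (i := i) hi
  have hp := natFun_lt ρ.symm hM
  have hp' := natFun_lt ρ'.symm hM
  have hf := fun i hi => natFun_inflation hv hM ρ π (i := i) hi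
  have hf' := fun i hi => natFun_inflation hv hM ρ' π' (i := i) hi
  have hz := natFun_symm ρ 0
  have hz' := natFun_symm ρ' 0
  rw [h] at hb hf
  generalize natFun ρ.symm 0 = a at *
  generalize natFun ρ'.symm 0 = a' at *
  -- Both intervals are the set of positions with entries below v in the same permutation.
  have haa : a = a' := by
    have h1 := hb a (by lia)
    have h2 := hb a' (by lia)
    have h3 := hb' a (by lia)
    have h4 := hb' a' (by lia)
    lia
  subst haa
  constructor
  · apply natFun_ext
    intro i hi
    rcases lt_trichotomy i a with h | h | h
    · have h1 := hf i (by lia)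
      have h2 := hf' i (by lia)
      simp only [inflate, h, if_pos] at h1 h2
      lia
    · rw [h, hz, hz']
    · have h1 := hf (i + v - 1) (by lia)
      have h2 := hf' (i + v - 1) (by lia)
      unfold inflate at h1 h2
      rw [if_neg (by lia), if_neg (by lia), if_pos (by lia),
        show i + v - 1 + 1 - v = i by lia] at h1 h2
      lia
  · apply natFun_ext
    intro i hi
    have h1 := hf (a + i) (by lia)
    have h2 := hf' (a + i) (by lia)
    unfold inflate at h1 h2
    rw [if_neg (by lia), if_pos (by lia), show a + i - a = i by lia] at h1 h2
    lia

theorem exists_inflation_eq (σ : Equiv.Perm (Fin (M + v))) (hσ : σ ∈ avoiders (M + v))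
    (hlast : natFun σ (M + v - 1) = v) :
    ∃ ρ ∈ avoiders M, ∃ π ∈ avoiders v, inflation ρ π = σ := by
  rw [mem_avoiders_iff] at hσ
  obtain ⟨a, ha, hblock⟩ := exists_block hv σ hσ hlast
  have hlt := fun i => natFun_lt σ (i := i)
  have hinj := fun i j => natFun_inj σ (i := i) (j := j)
  have hne : ∀ i, i + 1 < M + v → natFun σ i ≠ v := by
    intro i hi h
    have := hinj i (M + v - 1) (by lia) (by lia) (by lia)
    lia
  -- `e` embeds the contracted positions into those of σ; the start `a` of the block represents the
  -- whole block.
  obtain ⟨e, he⟩ : ∃ e : ℕ → ℕ, ∀ i, e i = if i ≤ a then i else i + v - 1 := ⟨_, fun _ => rfl⟩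
  have hgt : ∀ i < M, i ≠ a → v < natFun σ (e i) := by
    intro i hi h
    have h1 := hblock (e i)
    have h2 := hne (e i)
    rw [he] at *
    split_ifs at * <;> lia
  have hemono : ∀ i j, i < j → e i < e j := by
    intro i j h
    rw [he, he]
    split_ifs <;> lia
  have helt : ∀ i < M, e i + 1 < M + v := by
    intro i hi
    rw [he]
    split_ifs <;> lia
  have hea : natFun σ (e a) < v := by
    rw [he, if_pos le_rfl, hblock a (by lia)]
    lia
  -- Truncated subtraction sends the block's representative to 0; all other entries met by `e`
  -- exceed v and stay positive.
  obtain ⟨r, hr⟩ : ∃ r : ℕ → ℕ, ∀ i, r i = natFun σ (e i) - v := ⟨_, fun _ => rfl⟩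
  have hra : r a = 0 := by
    rw [hr]
    lia
  have hr1 : ∀ i < M, r i < M := by
    intro i hi
    have := hlt (e i) (by have := helt i hi; lia)
    rw [hr]
    lia
  have hr2 : ∀ i < M, ∀ j < M, r i = r j → i = j := by
    intro i hi j hj h
    rw [hr, hr] at h
    by_contra hij
    have h1 := hgt i hi
    have h2 := hgt j hj
    have h3 : natFun σ (e i) = natFun σ (e j) := by
      by_cases hia : i = a
      · subst hia
        lia
      · by_cases hja : j = a
        · subst hja
          lia
        · lia
    have h4 := hinj _ _ (by have := helt i hi; lia) (by have := helt j hj; lia) h3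
    rcases lt_or_gt_of_ne hij with h | h
    · have := hemono _ _ h
      lia
    · have := hemono _ _ h
      lia
  have hrlt : ∀ i j, r i < r j → natFun σ (e i) < natFun σ (e j) := by
    intro i j h
    rw [hr, hr] at h
    lia
  have hq1 : ∀ i < v, natFun σ (a + i) < v := by
    intro i hi
    rw [hblock _ (by lia)]
    lia
  have hq2 : ∀ i < v, ∀ j < v, natFun σ (a + i) = natFun σ (a + j) → i = j := by
    intro i hi j hj h
    have := hinj _ _ (by lia) (by lia) h
    lia
  have hρ := fun i hi => natFun_ofNatFun hr1 hr2 (i := i) hi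
  have hπ := fun i hi => natFun_ofNatFun (f := fun i => natFun σ (a + i)) hq1 hq2 (i := i) hi
  set ρ := ofNatFun M r
  set π := ofNatFun v fun i => natFun σ (a + i)
  have hρa : natFun ρ.symm 0 = a := by
    refine natFun_inj ρ (natFun_lt _ (by lia)) ha ?_
    rw [natFun_symm, hρ a ha, hra]
  refine ⟨ρ, ?_, π, ?_, ?_⟩
  · rw [mem_avoiders_iff]
    refine SeqAvoids.congr (f := r) ?_ hρ
    intro x y z w hxy hyz hzw hw h1 h2 h3
    have := helt w hw
    exact hσ (e x) (e y) (e z) (e w) (hemono _ _ hxy) (hemono _ _ hyz) (hemono _ _ hzw) (by lia)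
      (hrlt _ _ h1) (hrlt _ _ h2) (hrlt _ _ h3)
  · rw [mem_avoiders_iff]
    refine SeqAvoids.congr (f := fun i => natFun σ (a + i)) ?_ hπ
    intro x y z w hxy hyz hzw hw h1 h2 h3
    exact hσ (a + x) (a + y) (a + z) (a + w) (by lia) (by lia) (by lia) (by lia) h1 h2 h3
  · apply natFun_ext
    intro i hi
    rw [natFun_inflation hv hM _ _ hi, hρa]
    unfold inflate
    split_ifs with h1 h2 h3
    · have hei : e i = i := by rw [he, if_pos (by lia)]
      have := hgt i (by lia) (by lia)
      rw [hei] at this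
      rw [hρ i (by lia), hr, hei]
      lia
    · rw [hπ _ (by lia), show a + (i - a) = i by lia]
    · have hei : e (i + 1 - v) = i := by
        rw [he, if_neg (by lia)]
        lia
      have := hgt (i + 1 - v) (by lia) (by lia)
      rw [hei] at this
      rw [hρ _ (by lia), hr, hei]
      lia
    · rw [show i = M + v - 1 by lia, hlast]

theorem bijOn_inflation : Set.BijOn (fun p : Equiv.Perm (Fin M) × Equiv.Perm (Fin v) =>
    inflation p.1 p.2) (avoiders M ×ˢ avoiders v)
    {σ | σ ∈ avoiders (M + v) ∧ natFun σ (M + v - 1) = v} := by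
  refine ⟨fun p hp => ⟨inflation_mem_avoiders hv hM hp.1 hp.2, natFun_inflation_last hv hM _ _⟩,
    fun p _ p' _ h => Prod.ext_iff.2 (inflation_inj hv hM h), fun σ hσ => ?_⟩
  obtain ⟨ρ, hρ, π, hπ, h⟩ := exists_inflation_eq hv hM σ hσ.1 hσ.2
  exact ⟨(ρ, π), ⟨hρ, hπ⟩, h⟩

theorem ncard_avoiders_last : {σ | σ ∈ avoiders (M + v) ∧ natFun σ (M + v - 1) = v}.ncard =
    (avoiders M).ncard * (avoiders v).ncard := by
  rw [← (bijOn_inflation hv hM).image_eq, (bijOn_inflation hv hM).injOn.ncard_image,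
    Set.ncard_prod]

end inflation

/-! ### Minimum and maximum under inflation -/

theorem mem_avoidersMaxAt_iff {n k : ℕ} (σ : Equiv.Perm (Fin n)) :
    σ ∈ avoidersMaxAt n k ↔ σ ∈ avoiders n ∧ natFun σ.symm 0 + 1 < k ∧ k ≤ n ∧
      natFun σ (k - 1) + 1 = n := by
  constructor
  · rintro ⟨⟨h, i, j', hij, hi, hj'⟩, j, rfl, hj⟩
    have hjj : j = j' := σ.injective (Fin.ext (by lia))
    subst hjj
    have h0 : natFun σ.symm 0 = i := by
      refine natFun_inj σ (natFun_lt _ (by lia)) i.2 ?_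
      rw [natFun_symm, natFun_coe]
      lia
    refine ⟨h, ?_, by lia, ?_⟩
    · rw [h0]
      have : (i : ℕ) < j := hij
      lia
    · rw [Nat.add_sub_cancel, natFun_coe, hj]
  · rintro ⟨h, h1, h2, h3⟩
    have e1 := natFun_coe σ ⟨natFun σ.symm 0, by lia⟩
    have e2 := natFun_coe σ ⟨k - 1, by lia⟩
    simp only [natFun_symm] at e1 e2
    exact ⟨⟨h, ⟨natFun σ.symm 0, by lia⟩, ⟨k - 1, by lia⟩, by simp; lia, by lia, by lia⟩,
      ⟨k - 1, by lia⟩, by simp; lia, by lia⟩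

/-- Since M ≥ 2, the maximum lies outside the block and is not last. To the right of the block its
position exceeds the contracted one by v - 1; to the left of the block both sides are false. -/
theorem inflation_mem_avoidersMaxAt_iff {M v k : ℕ} (hv : 1 ≤ v) (hM : 2 ≤ M)
    {ρ : Equiv.Perm (Fin M)} {π : Equiv.Perm (Fin v)} (hρ : ρ ∈ avoiders M)
    (hπ : π ∈ avoiders v) :
    inflation ρ π ∈ avoidersMaxAt (M + v) k ↔ ρ ∈ avoidersMaxAt M (k + 1 - v) := by
  rw [mem_avoidersMaxAt_iff, mem_avoidersMaxAt_iff]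
  simp only [hρ, inflation_mem_avoiders hv (by lia) hρ hπ, true_and]
  have h0 := natFun_lt (inflation ρ π).symm (i := 0) (by lia)
  have h1 := (natFun_inflation_lt_iff hv (by lia) ρ π h0).1 (by rw [natFun_symm]; lia)
  have h2 := natFun_lt ρ.symm (i := 0) (by lia)
  by_cases hk : 1 ≤ k ∧ k ≤ M + v
  · have h3 := natFun_inflation_lt_iff hv (by lia) ρ π (i := k - 1) (by lia)
    have h4 := natFun_inflation hv (by lia) ρ π (i := k - 1) (by lia)
    have h5 := natFun_lt π (i := k - 1 - natFun ρ.symm 0)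
    unfold inflate at h4
    rw [show k + 1 - v - 1 = k - 1 + 1 - v by lia]
    split_ifs at h4 <;> lia
  · lia

/-! ### Counting recurrences -/

theorem natFun_eq_iff {n : ℕ} (σ : Equiv.Perm (Fin n)) {i j : ℕ} (hi : i < n) :
    natFun σ i = j ↔ natFun σ.symm j = i := by
  constructor
  · rintro rfl
    exact natFun_symm σ.symm i
  · rintro rfl
    exact natFun_symm σ j

theorem ncard_eq_sum_last {n : ℕ} (A : Set (Equiv.Perm (Fin (n + 1)))) :
    A.ncard = ∑ v ∈ Finset.range (n + 1), {σ | σ ∈ A ∧ natFun σ n = v}.ncard := by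
  classical
  rw [Set.ncard_eq_toFinset_card', Finset.card_eq_sum_card_fiberwise
    (f := fun σ => natFun σ n) (t := Finset.range (n + 1))
    (fun σ _ => by simpa using natFun_lt σ (Nat.lt_succ_self n))]
  refine Finset.sum_congr rfl fun v _ => ?_
  rw [Set.ncard_eq_toFinset_card']
  congr 1
  ext σ
  simp

/-- A final minimum cannot be the 3 of a forbidden pattern, so it can be removed or added freely.
Inflation does not cover this case, as it needs a nonempty block. -/
theorem ncard_avoiders_last_zero (n : ℕ) :
    {σ | σ ∈ avoiders (n + 1) ∧ natFun σ n = 0}.ncard = (avoiders n).ncard := by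
  have hF : ∀ (τ : Equiv.Perm (Fin n)), ∀ i < n + 1,
      natFun (ofNatFun (n + 1) fun i => if i < n then natFun τ i + 1 else 0) i =
        if i < n then natFun τ i + 1 else 0 := by
    intro τ i hi
    refine natFun_ofNatFun ?_ ?_ hi
    · intro i _
      have := natFun_lt τ (i := i)
      split_ifs <;> lia
    · intro i hi j hj h
      have := natFun_inj τ (i := i) (j := j)
      split_ifs at h <;> lia
  symm
  refine Set.ncard_congr
    (fun τ _ => ofNatFun (n + 1) fun i => if i < n then natFun τ i + 1 else 0) ?_ ?_ ?_
  · intro τ hτ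
    rw [mem_avoiders_iff] at hτ
    refine ⟨?_, by simp [hF τ n (by lia)]⟩
    rw [mem_avoiders_iff]
    refine SeqAvoids.congr ?_ (hF τ)
    intro x y z w hxy hyz hzw hw h1 h2 h3
    beta_reduce at h1 h2 h3
    by_cases h : w < n
    · simp only [h, hzw.trans h, (hyz.trans hzw).trans h, ((hxy.trans hyz).trans hzw).trans h,
        if_true] at h1 h2 h3
      exact hτ x y z w hxy hyz hzw h (by lia) (by lia) (by lia)
    · simp [h] at h1
  · intro τ τ' _ _ h
    apply natFun_ext
    intro i hi
    have h1 := hF τ i (by lia)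
    have h2 := hF τ' i (by lia)
    rw [h, if_pos hi] at h1
    rw [if_pos hi] at h2
    lia
  · rintro σ ⟨hσ, h0⟩
    rw [mem_avoiders_iff] at hσ
    have hpos : ∀ i < n, 0 < natFun σ i := by
      intro i hi
      by_contra h
      have := natFun_inj σ (i := i) (j := n) (by lia) (by lia) (by lia)
      lia
    have hτ : ∀ i < n, natFun (ofNatFun n fun i => natFun σ i - 1) i = natFun σ i - 1 := by
      intro i hi
      refine natFun_ofNatFun ?_ ?_ hi
      · intro i hi
        have := natFun_lt σ (i := i) (by lia)
        have := hpos i hi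
        lia
      · intro i hi j hj h
        have h1 := hpos i hi
        have h2 := hpos j hj
        exact natFun_inj σ (by lia) (by lia) (by lia)
    refine ⟨ofNatFun n fun i => natFun σ i - 1, ?_, ?_⟩
    · rw [mem_avoiders_iff]
      refine SeqAvoids.congr ?_ hτ
      intro x y z w hxy hyz hzw hw h1 h2 h3
      exact hσ x y z w hxy hyz hzw (by lia) (by lia) (by lia) (by lia)
    · apply natFun_ext
      intro i hi
      rw [hF _ i hi]
      split_ifs with h
      · have := hpos i h
        rw [hτ i h]
        lia
      · rw [show i = n by lia, h0]

theorem ncard_avoiders_succ (n : ℕ) : (avoiders (n + 1)).ncard = (avoiders n).ncard +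
    ∑ v ∈ Finset.range n, (avoiders (v + 1)).ncard * (avoiders (n - v)).ncard := by
  rw [ncard_eq_sum_last, Finset.sum_range_succ', ncard_avoiders_last_zero, add_comm]
  congr 1
  refine Finset.sum_congr rfl fun v hv => ?_
  rw [Finset.mem_range] at hv
  obtain ⟨M, rfl⟩ : ∃ M, n = M + v := ⟨n - v, by lia⟩
  rw [Nat.add_sub_cancel, mul_comm]
  exact ncard_avoiders_last (M := M) (v := v + 1) (by lia) (by lia)

theorem ncard_avoiders_zero : (avoiders 0).ncard = 1 := by
  rw [Set.ncard_eq_one]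
  refine ⟨1, Set.eq_singleton_iff_unique_mem.2 ⟨?_, fun _ _ => Subsingleton.elim _ _⟩⟩
  rw [mem_avoiders_iff]
  intro p q r s _ _ _ h
  lia

theorem ncard_avoiders (n : ℕ) : (avoiders (n + 1)).ncard = Nat.largeSchroder n := by
  induction n using Nat.strong_induction_on with
  | _ n ih =>
    rw [ncard_avoiders_succ]
    cases n with
    | zero => simp [ncard_avoiders_zero]
    | succ n =>
      rw [Nat.largeSchroder_succ, ih n (by lia), Finset.Iic_eq_Icc, Nat.bot_eq_zero,
        ← Nat.range_succ_eq_Icc_zero]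
      congr 1
      refine Finset.sum_congr rfl fun v hv => ?_
      rw [Finset.mem_range] at hv
      rw [ih v hv, show n + 1 - v = n - v + 1 by lia, ih (n - v) (by lia)]

theorem two_le_of_mem_avoidersMaxAt {n k : ℕ} {σ : Equiv.Perm (Fin n)}
    (h : σ ∈ avoidersMaxAt n k) : 2 ≤ k ∧ k ≤ n := by
  rw [mem_avoidersMaxAt_iff] at h
  lia

theorem maxAtCount_eq_zero {n k : ℕ} (h : ¬ (2 ≤ k ∧ k ≤ n)) : maxAtCount n k = 0 := by
  rw [maxAtCount, Set.ncard_eq_zero, Set.eq_empty_iff_forall_notMem]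
  exact fun σ hσ => h (two_le_of_mem_avoidersMaxAt hσ)

theorem ncard_avoidersMaxAt_last {M v k : ℕ} (hv : 1 ≤ v) (hM : 2 ≤ M) :
    {σ | σ ∈ avoidersMaxAt (M + v) k ∧ natFun σ (M + v - 1) = v}.ncard =
      maxAtCount M (k + 1 - v) * (avoiders v).ncard := by
  have hbij := bijOn_inflation (M := M) hv (by lia)
  have hsub : avoidersMaxAt M (k + 1 - v) ⊆ avoiders M := fun _ h => h.1.1
  rw [maxAtCount, ← Set.ncard_prod,
    ← (hbij.injOn.mono (Set.prod_mono_left hsub)).ncard_image]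
  congr 1
  ext σ
  constructor
  · rintro ⟨h1, h2⟩
    obtain ⟨p, hp, rfl⟩ := hbij.surjOn ⟨h1.1.1, h2⟩
    exact ⟨p, ⟨(inflation_mem_avoidersMaxAt_iff hv hM hp.1 hp.2).1 h1, hp.2⟩, rfl⟩
  · rintro ⟨p, hp, rfl⟩
    exact ⟨(inflation_mem_avoidersMaxAt_iff hv hM (hsub hp.1) hp.2).2 hp.1,
      (hbij.mapsTo ⟨hsub hp.1, hp.2⟩).2⟩

theorem ncard_avoidersMaxAt_last_max (n k : ℕ) :
    {σ | σ ∈ avoidersMaxAt (n + 2) k ∧ natFun σ (n + 1) = n + 1}.ncard =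
      if k = n + 2 then Nat.largeSchroder n else 0 := by
  split_ifs with hk
  · subst hk
    -- With M = 1 the permutation is the block followed by its maximum, so 1 precedes n
    -- automatically.
    have h := ncard_avoiders_last (M := 1) (v := n + 1) (by lia) le_rfl
    rw [ncard_avoiders, ncard_avoiders, Nat.largeSchroder_zero, one_mul,
      show 1 + (n + 1) = n + 2 by lia] at h
    rw [← h]
    congr 1
    ext σ
    rw [Set.mem_ofPred_eq, Set.mem_ofPred_eq, mem_avoidersMaxAt_iff]
    simp only [Nat.add_one_sub_one]
    have h0 := natFun_lt σ.symm (i := 0) (n := n + 2) (by lia)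
    have h1 := natFun_symm σ 0
    have h2 : natFun σ.symm 0 = n + 1 → natFun σ (n + 1) = 0 := fun h => by rw [← h, h1]
    lia
  · rw [Set.ncard_eq_zero, Set.eq_empty_iff_forall_notMem]
    rintro σ ⟨h1, h2⟩
    rw [mem_avoidersMaxAt_iff] at h1
    have := natFun_inj σ (i := k - 1) (j := n + 1) (by lia) (by lia) (by lia)
    lia

theorem maxAtCount_add_two (n k : ℕ) : maxAtCount (n + 2) k =
    (if k = n + 2 then Nat.largeSchroder n else 0) +
      ∑ v ∈ Finset.range n, Nat.largeSchroder v * maxAtCount (n + 1 - v) (k - v) := by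
  have h0 : {σ | σ ∈ avoidersMaxAt (n + 2) k ∧ natFun σ (n + 1) = 0}.ncard = 0 := by
    rw [Set.ncard_eq_zero, Set.eq_empty_iff_forall_notMem]
    rintro σ ⟨h1, h2⟩
    rw [mem_avoidersMaxAt_iff] at h1
    rw [natFun_eq_iff σ (by lia)] at h2
    lia
  rw [maxAtCount, ncard_eq_sum_last, Finset.sum_range_succ', h0, Finset.sum_range_succ,
    ncard_avoidersMaxAt_last_max, add_zero, add_comm]
  congr 1
  refine Finset.sum_congr rfl fun v hv => ?_
  rw [Finset.mem_range] at hv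
  obtain ⟨M, rfl⟩ : ∃ M, n = M + v := ⟨n - v, by lia⟩
  have h := ncard_avoidersMaxAt_last (M := M + 1) (v := v + 1) (k := k) (by lia) (by lia)
  rw [ncard_avoiders] at h
  rw [mul_comm, show M + v + 1 - v = M + 1 by lia, show k - v = k + 1 - (v + 1) by lia, ← h,
    show M + 1 + (v + 1) - 1 = M + v + 1 by lia]
  -- The type of σ depends on the size, so equal sizes are transported by substitution rather than
  -- rewriting.
  have : ∀ a b : ℕ, a = b → {σ : Equiv.Perm (Fin a) | σ ∈ avoidersMaxAt a k ∧
      natFun σ (M + v + 1) = v + 1}.ncard = {σ : Equiv.Perm (Fin b) | σ ∈ avoidersMaxAt b k ∧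
      natFun σ (M + v + 1) = v + 1}.ncard := by
    rintro a _ rfl
    rfl
  exact this _ _ (by lia)

/-- This form holds for all n and k, as the generating functions require: the added terms vanish
because `maxAtCount` is zero outside 2 ≤ k ≤ n, and in particular wherever a subtraction truncates.
-/
theorem maxAtCount_rec (n k : ℕ) : maxAtCount n k =
    (if 2 ≤ n ∧ k = n then Nat.largeSchroder (n - 2) else 0) +
      ∑ v ∈ Finset.range n, Nat.largeSchroder v * maxAtCount (n - 1 - v) (k - v) := by
  obtain h | ⟨n, rfl⟩ : n < 2 ∨ ∃ m, n = m + 2 := by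
    by_cases h : n < 2
    · exact Or.inl h
    · exact Or.inr ⟨n - 2, by lia⟩
  · rw [maxAtCount_eq_zero (by lia), if_neg (by lia), Finset.sum_eq_zero fun v _ => ?_, add_zero]
    rw [maxAtCount_eq_zero (by lia), mul_zero]
  · rw [maxAtCount_add_two, Finset.sum_range_succ, Finset.sum_range_succ,
      maxAtCount_eq_zero (n := n + 2 - 1 - n) (by lia),
      maxAtCount_eq_zero (n := n + 2 - 1 - (n + 1)) (by lia)]
    simp

theorem ncard_avoidersOneBeforeMax (n : ℕ) :
    (avoidersOneBeforeMax n).ncard = ∑ k ∈ Finset.range (n + 1), maxAtCount n k := by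
  classical
  rw [Set.ncard_eq_toFinset_card', Finset.card_eq_sum_card_fiberwise
    (f := fun σ => natFun σ.symm (n - 1) + 1) (t := Finset.range (n + 1))]
  · refine Finset.sum_congr rfl fun k hk => ?_
    rw [maxAtCount, Set.ncard_eq_toFinset_card']
    congr 1
    ext σ
    simp only [Finset.mem_filter, Set.mem_toFinset]
    refine ⟨fun ⟨h, hk⟩ => ⟨h, ?_⟩, fun ⟨h, j, hj, hj'⟩ => ⟨h, ?_⟩⟩
    · obtain ⟨_, i, j, hij, _, hj⟩ := h
      refine ⟨j, ?_, hj⟩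
      rw [← hk, (natFun_eq_iff σ j.2).1]
      rw [natFun_coe]
      lia
    · rw [← hj, (natFun_eq_iff σ j.2).1]
      rw [natFun_coe]
      lia
  · intro σ h
    simp only [Set.coe_toFinset] at h
    obtain ⟨_, i, j, hij, _, hj⟩ := h
    have := natFun_lt σ.symm (i := n - 1) (by lia)
    simp
    lia

theorem ncard_avoidersOneBeforeMax_rec (n : ℕ) : (avoidersOneBeforeMax n).ncard =
    (if 2 ≤ n then Nat.largeSchroder (n - 2) else 0) +
      ∑ v ∈ Finset.range n, Nat.largeSchroder v * (avoidersOneBeforeMax (n - 1 - v)).ncard := by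
  rw [ncard_avoidersOneBeforeMax]
  simp_rw [maxAtCount_rec n]
  rw [Finset.sum_add_distrib]
  congr 1
  · by_cases h : 2 ≤ n <;> simp [h]
  · rw [Finset.sum_comm]
    refine Finset.sum_congr rfl fun v hv => ?_
    rw [Finset.mem_range] at hv
    rw [← Finset.mul_sum, ncard_avoidersOneBeforeMax,
      -- The terms with k < v have truncated index 0 and vanish; the top term has its index above
      -- the size n - 1 - v and vanishes too.
      show n + 1 = v + (n - 1 - v + 1 + 1) by lia, Finset.sum_range_add,
      Finset.sum_eq_zero fun k hk => ?_, zero_add, Finset.sum_range_succ,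
      maxAtCount_eq_zero (k := v + (n - 1 - v + 1) - v) (by lia), add_zero]
    · congr 1
      refine Finset.sum_congr rfl fun k _ => ?_
      congr 1
      lia
    · rw [Finset.mem_range] at hk
      exact maxAtCount_eq_zero (by lia)

/-! ### Series in one variable -/

/-- The generating function of the large Schröder numbers. -/
noncomputable def schroderL : PowerSeries ℚ :=
  PowerSeries.mk fun n => (Nat.largeSchroder n : ℚ)

theorem schroderS_eq : schroderS = 1 + PowerSeries.X * schroderL := by
  ext n
  cases n with
  | zero => simp [schroderS]
  | succ n => simp [schroderS, schroderL, PowerSeries.coeff_succ_X_mul, PowerSeries.coeff_one]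

theorem schroderL_eq :
    schroderL = 1 + PowerSeries.X * schroderL + PowerSeries.X * schroderL ^ 2 := by
  have h := congrArg (PowerSeries.map (Nat.castRingHom ℚ)) PowerSeries.largeSchroderSeries_eq_one_add_X_mul_largeSchroderSeries_add_X_mul_largeSchroderSeries_sq
  have hL : PowerSeries.map (Nat.castRingHom ℚ) PowerSeries.largeSchroderSeries = schroderL := by
    ext n
    simp [schroderL]
  simpa [hL] using h

theorem schroderS_sq : schroderS ^ 2 = (3 - PowerSeries.X) * schroderS - 2 := by
  rw [schroderS_eq]
  linear_combination -PowerSeries.X * schroderL_eq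

theorem two_mul_C_half : 2 * PowerSeries.C (1 / 2 : ℚ) = 1 := by
  rw [← map_ofNat (PowerSeries.C (R := ℚ)) 2, ← map_mul]
  norm_num

theorem exists_sqrt : ∃ R : PowerSeries ℚ, PowerSeries.constantCoeff R = 1 ∧
    R ^ 2 = PowerSeries.X ^ 2 - 6 * PowerSeries.X + 1 ∧
    schroderS = PowerSeries.C (1 / 2 : ℚ) * (3 - PowerSeries.X - R) := by
  -- The root is obtained by solving the claimed formula for R; its square comes from the quadratic
  -- equation for S.
  refine ⟨3 - PowerSeries.X - 2 * schroderS, ?_, ?_, ?_⟩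
  · rw [schroderS_eq]
    simp [map_ofNat (PowerSeries.constantCoeff (R := ℚ))]
    norm_num
  · linear_combination 4 * schroderS_sq
  · linear_combination -schroderS * two_mul_C_half

/-- The generating function of the avoiders with `1` before the maximum. -/
noncomputable def oneBeforeMaxSeries : PowerSeries ℚ :=
  PowerSeries.mk fun n => ((avoidersOneBeforeMax n).ncard : ℚ)

theorem oneBeforeMaxSeries_eq : oneBeforeMaxSeries = PowerSeries.X * (schroderS - 1) +
    (schroderS - 1) * oneBeforeMaxSeries := by
  have h : schroderS - 1 = PowerSeries.X * schroderL := by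
    rw [schroderS_eq]
    ring
  rw [h]
  ext n
  rw [oneBeforeMaxSeries, PowerSeries.coeff_mk, ncard_avoidersOneBeforeMax_rec, map_add]
  push_cast
  congr 1
  · obtain _ | _ | n := n <;> simp [PowerSeries.coeff_succ_X_mul, schroderL]
  · rw [mul_assoc]
    cases n with
    | zero => simp
    | succ n =>
      rw [PowerSeries.coeff_succ_X_mul, PowerSeries.coeff_mul,
        Finset.Nat.sum_antidiagonal_eq_sum_range_succ_mk]
      simp [schroderL]

theorem oneBeforeMaxSeries_mul : oneBeforeMaxSeries * (2 - schroderS) =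
    PowerSeries.X * (schroderS - 1) := by
  linear_combination oneBeforeMaxSeries_eq

theorem constantCoeff_two_sub_schroderS :
    PowerSeries.constantCoeff (2 - schroderS) = 1 := by
  rw [schroderS_eq]
  simp [map_ofNat (PowerSeries.constantCoeff (R := ℚ))]
  norm_num

theorem oneBeforeMaxSeries_eq_mul_inv : oneBeforeMaxSeries =
    PowerSeries.X * (schroderS - 1) * (2 - schroderS)⁻¹ := by
  rw [PowerSeries.eq_mul_inv_iff_mul_eq (by simp [constantCoeff_two_sub_schroderS]),
    oneBeforeMaxSeries_mul]

theorem maxAtSeriesAtOne_eq : maxAtSeriesAtOne = oneBeforeMaxSeries := by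
  ext n
  rw [maxAtSeriesAtOne, oneBeforeMaxSeries, PowerSeries.coeff_mk, PowerSeries.coeff_mk,
    ncard_avoidersOneBeforeMax]
  push_cast
  split_ifs with h
  · refine Finset.sum_subset (fun k => by simp) fun k _ hk => ?_
    rw [Finset.mem_Icc] at hk
    rw [maxAtCount_eq_zero hk, Nat.cast_zero]
  · refine (Finset.sum_eq_zero fun k _ => ?_).symm
    rw [maxAtCount_eq_zero (by lia), Nat.cast_zero]

/-- The quadratic equation for S gives (S - 1 - x)(2 - S) = 2x(S - 1), and 2 - S can be cancelled.
-/
theorem two_mul_oneBeforeMaxSeries :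
    2 * oneBeforeMaxSeries = schroderS - 1 - PowerSeries.X := by
  have h0 : (2 - schroderS) ≠ 0 := fun h => by
    have := constantCoeff_two_sub_schroderS
    simp [h] at this
  refine mul_right_cancel₀ h0 ?_
  linear_combination 2 * oneBeforeMaxSeries_mul + schroderS_sq

theorem ncard_avoidersOneBeforeMax_eq_smallSchroder {n : ℕ} (hn : 2 ≤ n) :
    (avoidersOneBeforeMax n).ncard = Nat.smallSchroder n := by
  obtain ⟨n, rfl⟩ : ∃ m, n = m + 2 := ⟨n - 2, by lia⟩
  have h := congrArg (PowerSeries.coeff (n + 2)) two_mul_oneBeforeMaxSeries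
  rw [two_mul, map_add, oneBeforeMaxSeries, PowerSeries.coeff_mk, schroderS] at h
  simp [PowerSeries.coeff_one, PowerSeries.coeff_X] at h
  have h2 := Nat.two_mul_smallSchroder_succ (n := n + 1) (by lia)
  have h3 : (avoidersOneBeforeMax (n + 2)).ncard + (avoidersOneBeforeMax (n + 2)).ncard =
      Nat.largeSchroder (n + 1) := by exact_mod_cast h
  lia

/-! ### Series in two variables -/

open MvPowerSeries in
theorem coeff_subst_varX_mul_varT (f : PowerSeries ℚ) (m : Fin 2 →₀ ℕ) :
    coeff m (PowerSeries.subst (varX * varT) f) =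
      if m 0 = m 1 then PowerSeries.coeff (m 0) f else 0 := by
  have hpow : ∀ d : ℕ, coeff m ((varX * varT) ^ d) = if m 0 = d ∧ m 1 = d then 1 else 0 := by
    intro d
    rw [mul_pow, varX, varT, X_pow_eq, X_pow_eq, monomial_mul_monomial, coeff_monomial, one_mul]
    congr 1
    rw [Finsupp.ext_iff, Fin.forall_fin_two]
    simp
  rw [PowerSeries.coeff_subst hasSubst_varX_mul_varT]
  simp_rw [hpow]
  rw [finsum_eq_single _ (m 0)]
  · by_cases h : m 0 = m 1 <;> simp [h, eq_comm]
  · intro d hd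
    simp [hd.symm]

/-- The exponent vector of `x ^ a * t ^ b`. -/
noncomputable def expVec (a b : ℕ) : Fin 2 →₀ ℕ := Finsupp.single 0 a + Finsupp.single 1 b

theorem expVec_zero (a b : ℕ) : expVec a b 0 = a := by simp [expVec]

theorem expVec_one (a b : ℕ) : expVec a b 1 = b := by simp [expVec]

theorem eq_expVec (m : Fin 2 →₀ ℕ) : m = expVec (m 0) (m 1) := by
  rw [Finsupp.ext_iff, Fin.forall_fin_two, expVec_zero, expVec_one]
  simp

-- Only the diagonal monomials x^v t^v occur in f(xt), so the product formula collapses to a single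
-- sum. Any sufficiently large `N` may bound it, which lets the range match that of the recurrence.
open MvPowerSeries in
theorem coeff_subst_varX_mul_varT_mul (f : PowerSeries ℚ) (g : MvPowerSeries (Fin 2) ℚ)
    {n k N : ℕ} (hN : ∀ v, v ≤ n → v ≤ k → v < N) :
    coeff (expVec n k) (PowerSeries.subst (varX * varT) f * g) =
      ∑ v ∈ Finset.range N, if v ≤ n ∧ v ≤ k then
        PowerSeries.coeff v f * coeff (expVec (n - v) (k - v)) g else 0 := by
  classical
  rw [coeff_mul, ← Finset.sum_filter]
  symm
  refine Finset.sum_bij_ne_zero (fun v _ _ => (expVec v v, expVec (n - v) (k - v))) ?_ ?_ ?_ ?_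
  · intro v hv _
    rw [Finset.mem_filter] at hv
    rw [Finset.HasAntidiagonal.mem_antidiagonal, Finsupp.ext_iff, Fin.forall_fin_two]
    simp only [Finsupp.add_apply, expVec_zero, expVec_one]
    lia
  · intro v _ _ w _ _ h
    simpa only [expVec_zero] using congrArg (fun p : (Fin 2 →₀ ℕ) × (Fin 2 →₀ ℕ) => p.1 0) h
  · rintro ⟨a, b⟩ hab hne
    rw [Finset.HasAntidiagonal.mem_antidiagonal, Finsupp.ext_iff, Fin.forall_fin_two] at hab
    simp only [Finsupp.add_apply, expVec_zero, expVec_one] at hab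
    rw [coeff_subst_varX_mul_varT] at hne
    have ha : a 0 = a 1 := by
      by_contra h
      simp [h] at hne
    have e1 : expVec (a 0) (a 0) = a := by
      conv_rhs => rw [eq_expVec a, ← ha]
    have e2 : expVec (n - a 0) (k - a 0) = b := by
      conv_rhs => rw [eq_expVec b]
      congr 1 <;> lia
    refine ⟨a 0, ?_, ?_, by rw [e1, e2]⟩
    · rw [Finset.mem_filter, Finset.mem_range]
      exact ⟨hN _ (by lia) (by lia), by lia, by lia⟩
    · rw [e2]
      simpa [ha] using hne
  · intro v _ _
    simp [coeff_subst_varX_mul_varT, expVec_zero, expVec_one]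

open MvPowerSeries in
theorem coeff_maxAtSeries (n k : ℕ) : coeff (expVec n k) maxAtSeries = maxAtCount n k := by
  change maxAtSeries (expVec n k) = _
  rw [maxAtSeries, expVec_zero, expVec_one]
  split_ifs with h
  · rfl
  · rw [maxAtCount_eq_zero (by lia), Nat.cast_zero]

theorem schroderSxt_sub_one :
    schroderSxt - 1 = PowerSeries.subst (varX * varT) (PowerSeries.X * schroderL) := by
  have h1 : PowerSeries.subst (varX * varT) (1 : PowerSeries ℚ) = 1 := by
    rw [← PowerSeries.coe_substAlgHom hasSubst_varX_mul_varT, map_one]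
  rw [schroderSxt, schroderS_eq, PowerSeries.subst_add hasSubst_varX_mul_varT, h1]
  ring

open MvPowerSeries in
theorem coeff_expVec_X_pow_mul (a b n k : ℕ) (f : MvPowerSeries (Fin 2) ℚ) :
    coeff (expVec n k) (varX ^ a * varT ^ b * f) =
      if a ≤ n ∧ b ≤ k then coeff (expVec (n - a) (k - b)) f else 0 := by
  rw [varX, varT, X_pow_eq, X_pow_eq, monomial_mul_monomial, coeff_monomial_mul, one_mul, one_mul]
  have h : Finsupp.single 0 a + Finsupp.single 1 b ≤ expVec n k ↔ a ≤ n ∧ b ≤ k := by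
    change expVec a b ≤ _ ↔ _
    rw [Finsupp.le_def, Fin.forall_fin_two]
    simp only [expVec_zero, expVec_one]
  have h' : expVec n k - (Finsupp.single 0 a + Finsupp.single 1 b) = expVec (n - a) (k - b) := by
    change _ - expVec a b = _
    rw [Finsupp.ext_iff, Fin.forall_fin_two]
    simp only [Finsupp.tsub_apply, expVec_zero, expVec_one, and_self]
  rw [h']
  exact if_congr h rfl rfl

/-- In `maxAtCount_rec` the x-exponent drops by v + 1 but the t-exponent only by v. The factor t
evens this out to (xt)^(v+1), whose coefficient in S(xt) is the Schröder number with index v. -/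
theorem varT_mul_maxAtSeries : varT * maxAtSeries =
    varX * varT ^ 2 * (schroderSxt - 1) + (schroderSxt - 1) * maxAtSeries := by
  rw [schroderSxt_sub_one]
  ext m
  obtain ⟨n, k, rfl⟩ : ∃ n k, m = expVec n k := ⟨_, _, eq_expVec m⟩
  have hT := coeff_expVec_X_pow_mul 0 1 n k maxAtSeries
  have hXT := coeff_expVec_X_pow_mul 1 2 n k
    (PowerSeries.subst (varX * varT) (PowerSeries.X * schroderL))
  rw [pow_zero, one_mul, pow_one] at hT
  rw [pow_one] at hXT
  rw [map_add, hT, hXT, coeff_subst_varX_mul_varT_mul (N := n + 1) _ _ (fun _ _ _ => by lia),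
    Finset.sum_range_succ', coeff_subst_varX_mul_varT, expVec_zero, expVec_one]
  simp only [coeff_maxAtSeries, PowerSeries.coeff_succ_X_mul, PowerSeries.coeff_zero_X_mul,
    zero_mul, ite_self, add_zero]
  cases k with
  | zero => simp
  | succ k =>
    rw [if_pos (by lia), Nat.sub_zero, Nat.add_sub_cancel, maxAtCount_rec]
    push_cast
    congr 1
    · obtain _ | _ | n := n
      · simp
      · simp [PowerSeries.coeff_zero_X_mul]
      · rw [Nat.add_one_sub_one, PowerSeries.coeff_succ_X_mul, schroderL, PowerSeries.coeff_mk]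
        split_ifs <;> first | rfl | lia
    · refine Finset.sum_congr rfl fun v hv => ?_
      rw [Finset.mem_range] at hv
      split_ifs with h
      · rw [show n - 1 - v = n - (v + 1) by lia]
        simp [schroderL]
      · rw [maxAtCount_eq_zero (by lia)]
        simp

theorem one_add_varT_sub_schroderSxt_ne_zero : 1 + varT - schroderSxt ≠ 0 := by
  intro h
  -- The coefficient of t is 1, since S(xt) has only diagonal monomials.
  have h1 := congrArg (MvPowerSeries.coeff (expVec 0 1)) h
  have h2 := coeff_expVec_X_pow_mul 0 1 0 1 1
  have h3 : expVec 0 0 = 0 := by simp [expVec]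
  rw [show (1 : MvPowerSeries (Fin 2) ℚ) + varT - schroderSxt = varT - (schroderSxt - 1) by ring,
    schroderSxt_sub_one, map_sub, coeff_subst_varX_mul_varT, expVec_zero, expVec_one] at h1
  simp [h3] at h2
  simp [h2] at h1

theorem mainTheorem8 :
    -- closed form of `S`; `R` is the formal square root of `x ^ 2 - 6 x + 1` with constant term `1`
    (∃ R : PowerSeries ℚ, PowerSeries.constantCoeff R = 1 ∧
      R ^ 2 = PowerSeries.X ^ 2 - 6 * PowerSeries.X + 1 ∧
      schroderS = PowerSeries.C (1 / 2 : ℚ) * (3 - PowerSeries.X - R)) ∧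
    -- the bivariate generating function, as a quotient in the fraction field of `ℚ⟦x, t⟧`
    (1 + varT - schroderSxt ≠ 0 ∧
      algebraMap (MvPowerSeries (Fin 2) ℚ) (FractionRing (MvPowerSeries (Fin 2) ℚ)) maxAtSeries =
        algebraMap _ _ (varX * varT ^ 2 * (schroderSxt - 1)) /
          algebraMap _ _ (1 + varT - schroderSxt)) ∧
    -- the specialization `t = 1` counts the avoiders with `1` before `n`
    (maxAtSeriesAtOne = PowerSeries.X * (schroderS - 1) * (2 - schroderS)⁻¹ ∧
      PowerSeries.mk (fun n => ((avoidersOneBeforeMax n).ncard : ℚ)) = maxAtSeriesAtOne ∧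
      ∀ n : ℕ, 2 ≤ n → (avoidersOneBeforeMax n).ncard = Nat.smallSchroder n) ∧
    -- the whole class
    ∀ n : ℕ, 1 ≤ n → (avoiders n).ncard = Nat.largeSchroder (n - 1) := by
  refine ⟨exists_sqrt, ⟨one_add_varT_sub_schroderSxt_ne_zero, ?_⟩,
    ⟨maxAtSeriesAtOne_eq.trans oneBeforeMaxSeries_eq_mul_inv, maxAtSeriesAtOne_eq.symm,
      fun _ => ncard_avoidersOneBeforeMax_eq_smallSchroder⟩, ?_⟩
  · rw [eq_div_iff, ← map_mul]
    · congr 1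
      linear_combination varT_mul_maxAtSeries
    · rw [Ne, FaithfulSMul.algebraMap_eq_zero_iff]
      exact one_add_varT_sub_schroderSxt_ne_zero
  · intro n hn
    obtain ⟨n, rfl⟩ : ∃ m, n = m + 1 := ⟨n - 1, by lia⟩
    exact ncard_avoiders n
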